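/- Let $\Omega=[0,1)^2$ and identify functions on $\Omega$ with functions on $\mathbb R^2$ that are $1$-periodic in each variable. A periodic $f$ belongs to $BV(\Omega)$ if $f\in L_1(\Omega)$ and its distributional first-order partial derivatives (as a periodic function) are Radon measures, i.e. there are finite signed Borel measures $\partial_1 f,\partial_2 f$ on $\Omega$ with $\int_\Omega f\,\partial_j\psi\,dx=-\int_\Omega\psi\,d(\partial_j f)$ for $j=1,2$ and all smooth functions $\psi$ on $\mathbb R^2$ that are $1$-periodic in each variable. Its anisotropic total variation is $\mathrm{TV}(f)=\int_\Omega d\|\nabla f\|_1=|\partial_1 f|(\Omega)+|\partial_2 f|(\Omega)$ (a jump of the periodic function across the seam $\partial[0,1]^2$ is counted, once). For $J\in\mathbb N=\{0,1,2,\dots\}$ and $k\in\{0,\dots,2^J-1\}^2$ let $$\mathbf f[k]=2^J\int_\Omega f(x)\,2^J 1_{\Omega}(2^Jx-k)\,dx,$$ which is the average of $f$ over the square $\prod_{j=1}^2[2^{-J}k_j,2^{-J}(k_j+1))$. Let $B_2(t)=\max\{1-|t|,0\}$, $\phi(x)=B_2(x_1)B_2(x_2)$, and $$f_J(x)=\sum_{k\in\{0,\dots,2^J-1\}^2}\mathbf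 f[k]\sum_{k'\in\mathbb Z^2}\phi(2^Jx-k+2^Jk').$$ If $f\in BV(\Omega)\cap L_\infty(\Omega)$, then for every $J\in\mathbb N$ $$\|f_J-f\|_{L_2(\Omega)}^2\le\left(16+4\sqrt{\pi}\right)2^{-J}\,\mathrm{TV}(f)\,\|f\|_{L_\infty(\Omega)}.$$ -/

import Mathlib

open MeasureTheory Set
open scoped ENNReal ContDiff

noncomputable section

namespace PeriodicBV

/-- The half-open unit square `[0,1)²`, a fundamental cell of `ℝ² / ℤ²`. -/
def unitSquare : Set (ℝ × ℝ) := Ico (0 : ℝ) 1 ×ˢ Ico (0 : ℝ) 1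

/-- Functions on `[0,1)²` are identified with functions on `ℝ²` of period `1` in each variable. -/
def IsPeriodic (f : ℝ × ℝ → ℝ) : Prop :=
  (∀ x, f (x + (1, 0)) = f x) ∧ (∀ x, f (x + (0, 1)) = f x)

/-- The integral over `[0,1)²` of `ψ` against a finite signed measure, computed from the Jordan
decomposition. -/
def signedIntegral (ψ : ℝ × ℝ → ℝ) (μ : SignedMeasure (ℝ × ℝ)) : ℝ :=
  (∫ x in unitSquare, ψ x ∂μ.toJordanDecomposition.posPart) -
    ∫ x in unitSquare, ψ x ∂μ.toJordanDecomposition.negPart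

/-- `μ` (on `[0,1)²`) is the distributional derivative in the direction `v` of the
periodic function `f`, tested against all smooth periodic functions. A finite signed measure on
`[0,1)²` is the same as a signed Radon measure on the torus, or a `ℤ²`-periodic one on the plane;
the values of `μ` outside `[0,1)²` play no role. -/
def IsDistribDeriv (f : ℝ × ℝ → ℝ) (v : ℝ × ℝ) (μ : SignedMeasure (ℝ × ℝ)) : Prop :=
  ∀ ψ : ℝ × ℝ → ℝ, ContDiff ℝ ∞ ψ → IsPeriodic ψ →
    ∫ x in unitSquare, f x * fderiv ℝ ψ x v = - signedIntegral ψ μ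

/-- The periodic function `f` is of bounded variation: it is integrable over the cell and its
first order distributional derivatives are Radon measures. -/
def IsBV (f : ℝ × ℝ → ℝ) : Prop :=
  IntegrableOn f unitSquare ∧
    (∃ μ, IsDistribDeriv f (1, 0) μ) ∧ (∃ μ, IsDistribDeriv f (0, 1) μ)

open Classical in
/-- The distributional derivative of `f` in the direction `v`, when it is a measure
(its restriction to `[0,1)²` is then unique), and `0` otherwise. -/
def derivMeasure (f : ℝ × ℝ → ℝ) (v : ℝ × ℝ) : SignedMeasure (ℝ × ℝ) :=
  if h : ∃ μ, IsDistribDeriv f v μ then h.choose else 0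

/-- The anisotropic total variation of `f` over `[0,1)²`: the variation, with respect to the
`ℓ¹` norm of `ℝ²`, of the vector measure `∇f` is the sum of the variations of its components. -/
def TV (f : ℝ × ℝ → ℝ) : ℝ≥0∞ :=
  (derivMeasure f (1, 0)).totalVariation unitSquare +
    (derivMeasure f (0, 1)).totalVariation unitSquare

/-- The scaled indicator `2 ^ J * 1_{[0,1)²} (2 ^ J x - k)`. -/
def boxFun (J : ℕ) (k : ℕ × ℕ) (x : ℝ × ℝ) : ℝ :=
  2 ^ J * unitSquare.indicator (fun _ => (1 : ℝ)) (2 ^ J * x.1 - k.1, 2 ^ J * x.2 - k.2)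

/-- The discrete sample at `k`, i.e. the mean of `f` over the cell of side `2 ^ (-J)` at `k`. -/
def sample (f : ℝ × ℝ → ℝ) (J : ℕ) (k : ℕ × ℕ) : ℝ :=
  2 ^ J * ∫ x in unitSquare, f x * boxFun J k x

/-- The piecewise linear B-spline. -/
def B₂ (t : ℝ) : ℝ := max (1 - |t|) 0

/-- The tensor product piecewise linear B-spline. -/
def phi (x : ℝ × ℝ) : ℝ := B₂ x.1 * B₂ x.2

/-- The periodization of `x ↦ phi (2 ^ J x - k)` (locally a finite sum). -/
def phiPer (J : ℕ) (k : ℕ × ℕ) (x : ℝ × ℝ) : ℝ :=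
  ∑' m : ℤ × ℤ, phi (2 ^ J * x.1 - k.1 + 2 ^ J * m.1, 2 ^ J * x.2 - k.2 + 2 ^ J * m.2)

/-- The interpolant of the samples on the grid `{0, …, 2 ^ J - 1}²`. -/
def interpolant (f : ℝ × ℝ → ℝ) (J : ℕ) (x : ℝ × ℝ) : ℝ :=
  ∑ k ∈ Finset.range (2 ^ J) ×ˢ Finset.range (2 ^ J), sample f J k * phiPer J k x

end PeriodicBV

end

noncomputable section

namespace PeriodicBV

open Filter Topology

/-! ### Periodic functions and integration over a period cell -/

/-! Put h = 2^{-J} and M = ‖f‖_∞. The squared error is bounded by (sup bound) × (L¹ bound). The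
periodized splines are nonnegative and sum to 1, so f_J(x) is a convex combination of cell averages,
and f_J(x) - f(x) is the same combination of the differences 𝐟[k] - f(x). Each difference is at most
2M. If the spline at k does not vanish at x, the cell at k lies, modulo ℤ², in x + [-h, 2h]², so the
difference is also at most h^{-2} ∫ |f(x+z) - f(x)| dz over that window
(`enorm_sample_sub_le_oscillation`).

The BV input is the translation estimate ‖f(· + z) - f‖₁ ≤ |z₁| |∂₁f|(Ω) + |z₂| |∂₂f|(Ω)
(`lintegral_translate_sub_le`), proved by duality: the difference quotient is moved to a smooth test
function and written there as a directional derivative. Since |z₁| and |z₂| each integrate to (15/2)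
h³ over the window, Tonelli bounds the integrated oscillation by (15/2) h TV(f)
(`lintegral_oscillation_le`). Multiplying by 2M gives the constant 15, which is below 16 + 4√π. -/

theorem eq_add_int_of_add_one {g : ℝ → ℝ} (h : ∀ t, g (t + 1) = g t) (m : ℤ) (t : ℝ) :
    g (t + m) = g t := by
  have h' : Function.Periodic g 1 := h
  simpa using h'.int_mul m t

theorem IsPeriodic.add_int {f : ℝ × ℝ → ℝ} (hf : IsPeriodic f) (m n : ℤ) (x : ℝ × ℝ) :
    f (x + ((m : ℝ), (n : ℝ))) = f x := by
  have h1 := eq_add_int_of_add_one (g := fun t => f (t, x.2 + n))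
    (fun t => by simpa using hf.1 (t, x.2 + n)) m x.1
  have h2 := eq_add_int_of_add_one (g := fun t => f (x.1, t))
    (fun t => by simpa using hf.2 (x.1, t)) n x.2
  calc f (x + ((m : ℝ), (n : ℝ))) = f (x.1 + m, x.2 + n) := rfl
    _ = f (x.1, x.2 + n) := h1
    _ = f x := h2

theorem IsPeriodic.comp_add {f : ℝ × ℝ → ℝ} (hf : IsPeriodic f) (z : ℝ × ℝ) :
    IsPeriodic fun x => f (x + z) :=
  ⟨fun _ => (congrArg f (add_right_comm _ _ _)).trans (hf.1 _),
    fun _ => (congrArg f (add_right_comm _ _ _)).trans (hf.2 _)⟩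

/-- The lattice `ℤ²` in the plane. -/
def lattice : AddSubgroup (ℝ × ℝ) :=
  (AddSubgroup.zmultiples (1 : ℝ)).prod (AddSubgroup.zmultiples (1 : ℝ))

theorem exists_int_of_lattice (g : lattice) : ∃ m n : ℤ, (g : ℝ × ℝ) = ((m : ℝ), (n : ℝ)) := by
  obtain ⟨⟨a, b⟩, ha, hb⟩ := g
  obtain ⟨m, rfl⟩ := AddSubgroup.mem_zmultiples_iff.1 ha
  obtain ⟨n, rfl⟩ := AddSubgroup.mem_zmultiples_iff.1 hb
  exact ⟨m, n, by simp⟩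

theorem mem_lattice (m n : ℤ) : ((m : ℝ), (n : ℝ)) ∈ lattice :=
  ⟨AddSubgroup.mem_zmultiples_iff.2 ⟨m, by simp⟩, AddSubgroup.mem_zmultiples_iff.2 ⟨n, by simp⟩⟩

instance : Countable lattice := by
  refine Function.Surjective.countable (α := ℤ × ℤ)
    (f := fun p => (⟨((p.1 : ℝ), (p.2 : ℝ)), mem_lattice _ _⟩ : lattice)) fun g => ?_
  obtain ⟨m, n, h⟩ := exists_int_of_lattice g
  exact ⟨(m, n), Subtype.ext h.symm⟩

/-- All unit boxes are fundamental domains of the same lattice, which makes integrals of periodic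
functions over the cell translation invariant. -/
theorem isAddFundamentalDomain_box (a b : ℝ) :
    IsAddFundamentalDomain lattice (Ico a (a + 1) ×ˢ Ico b (b + 1)) (volume : Measure (ℝ × ℝ)) := by
  refine IsAddFundamentalDomain.mk' (measurableSet_Ico.prod measurableSet_Ico).nullMeasurableSet
    fun x => ?_
  obtain ⟨m, hm, hm'⟩ := existsUnique_add_zsmul_mem_Ico one_pos x.1 a
  obtain ⟨n, hn, hn'⟩ := existsUnique_add_zsmul_mem_Ico one_pos x.2 b
  refine ⟨⟨((m : ℝ), (n : ℝ)), mem_lattice m n⟩, ?_, ?_⟩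
  · simp only [AddSubgroup.vadd_def, vadd_eq_add]
    refine ⟨?_, ?_⟩
    · simpa [add_comm] using hm
    · simpa [add_comm] using hn
  · intro g hg
    obtain ⟨m', n', h⟩ := exists_int_of_lattice g
    simp only [AddSubgroup.vadd_def, vadd_eq_add, h] at hg
    apply Subtype.ext
    have h1 := hm' m' (by simpa [add_comm] using hg.1)
    have h2 := hn' n' (by simpa [add_comm] using hg.2)
    rw [h, h1, h2]

theorem measurableSet_unitSquare : MeasurableSet unitSquare :=
  measurableSet_Ico.prod measurableSet_Ico

theorem volume_unitSquare : volume unitSquare = 1 := by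
  simp [unitSquare, Measure.volume_eq_prod, Measure.prod_prod]

instance : IsFiniteMeasure (volume.restrict unitSquare) :=
  ⟨by rw [Measure.restrict_apply_univ, volume_unitSquare]; exact ENNReal.one_lt_top⟩

theorem isAddFundamentalDomain_unitSquare :
    IsAddFundamentalDomain lattice unitSquare (volume : Measure (ℝ × ℝ)) := by
  simpa [unitSquare] using isAddFundamentalDomain_box 0 0

theorem preimage_add_box (z : ℝ × ℝ) :
    (fun x => x + z) ⁻¹' (Ico z.1 (z.1 + 1) ×ˢ Ico z.2 (z.2 + 1)) = unitSquare := by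
  ext x
  simp only [unitSquare, mem_preimage, mem_prod, Prod.fst_add, Prod.snd_add, mem_Ico]
  constructor
  · rintro ⟨⟨h1, h2⟩, h3, h4⟩; exact ⟨⟨by linarith, by linarith⟩, by linarith, by linarith⟩
  · rintro ⟨⟨h1, h2⟩, h3, h4⟩; exact ⟨⟨by linarith, by linarith⟩, by linarith, by linarith⟩

theorem vadd_lattice {β : Type*} {F : ℝ × ℝ → β}
    (hF : ∀ (m n : ℤ) (x : ℝ × ℝ), F (x + ((m : ℝ), (n : ℝ))) = F x) (g : lattice) (x : ℝ × ℝ) :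
    F (g +ᵥ x) = F x := by
  obtain ⟨m, n, h⟩ := exists_int_of_lattice g
  rw [AddSubgroup.vadd_def, vadd_eq_add, h, add_comm, hF]

theorem setLIntegral_add_of_periodic {F : ℝ × ℝ → ℝ≥0∞}
    (hF : ∀ (m n : ℤ) (x : ℝ × ℝ), F (x + ((m : ℝ), (n : ℝ))) = F x) (z : ℝ × ℝ) :
    ∫⁻ x in unitSquare, F (x + z) = ∫⁻ x in unitSquare, F x := by
  rw [← preimage_add_box z, (measurePreserving_add_right volume z).setLIntegral_comp_preimage_emb
    (measurableEmbedding_addRight z) F, preimage_add_box]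
  exact (isAddFundamentalDomain_box _ _).setLIntegral_eq isAddFundamentalDomain_unitSquare F
    (vadd_lattice hF)

theorem IsPeriodic.setIntegral_add {F : ℝ × ℝ → ℝ} (hF : IsPeriodic F) (z : ℝ × ℝ) :
    ∫ x in unitSquare, F (x + z) = ∫ x in unitSquare, F x := by
  rw [← preimage_add_box z, (measurePreserving_add_right volume z).setIntegral_preimage_emb
    (measurableEmbedding_addRight z) F, preimage_add_box]
  exact (isAddFundamentalDomain_box _ _).setIntegral_eq isAddFundamentalDomain_unitSquare
    (vadd_lattice hF.add_int)

/-- The representative of `x` modulo `ℤ²` in the unit square. -/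
def fractPt (x : ℝ × ℝ) : ℝ × ℝ := (Int.fract x.1, Int.fract x.2)

theorem fractPt_of_mem {x : ℝ × ℝ} (hx : x ∈ unitSquare) : fractPt x = x :=
  Prod.ext (Int.fract_eq_self.2 hx.1) (Int.fract_eq_self.2 hx.2)

theorem measurable_fractPt : Measurable fractPt :=
  (measurable_fst.fract).prodMk (measurable_snd.fract)

theorem isPeriodic_comp_fractPt (g : ℝ × ℝ → ℝ) : IsPeriodic (g ∘ fractPt) := by
  constructor <;> intro x <;> simp [fractPt]

/-- A bounded periodic function agrees almost everywhere on the cell with a measurable periodic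
function which is bounded everywhere by the essential supremum. -/
theorem exists_measurable_bounded_periodic {f : ℝ × ℝ → ℝ}
    (hf : MemLp f ∞ (volume.restrict unitSquare)) :
    ∃ g : ℝ × ℝ → ℝ, IsPeriodic g ∧ Measurable g ∧
      (∀ x, |g x| ≤ (eLpNorm f ∞ (volume.restrict unitSquare)).toReal) ∧
      f =ᵐ[volume.restrict unitSquare] g := by
  set M := (eLpNorm f ∞ (volume.restrict unitSquare)).toReal with hM
  have hM0 : 0 ≤ M := ENNReal.toReal_nonneg
  obtain ⟨g, hg, hfg⟩ := hf.aestronglyMeasurable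
  -- Clipping to [-M, M] turns the essential bound into a pointwise one; composing with `fractPt`
  -- restores periodicity.
  refine ⟨(fun x => max (-M) (min M (g x))) ∘ fractPt, isPeriodic_comp_fractPt _, ?_, ?_, ?_⟩
  · exact (measurable_const.max (measurable_const.min hg.measurable)).comp measurable_fractPt
  · intro x
    simp only [Function.comp]
    rw [abs_le]
    exact ⟨le_max_left _ _, max_le (by linarith) (min_le_left _ _)⟩
  · have hb : ∀ᵐ x ∂(volume.restrict unitSquare), |f x| ≤ M := by
      have h1 := ae_le_eLpNormEssSup (f := f) (μ := volume.restrict unitSquare)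
      filter_upwards [h1] with x hx
      rw [← eLpNorm_exponent_top] at hx
      have := ENNReal.toReal_mono hf.eLpNorm_ne_top hx
      rwa [toReal_enorm, Real.norm_eq_abs] at this
    filter_upwards [hb, hfg, ae_restrict_mem measurableSet_unitSquare] with x h1 h2 h3
    simp only [Function.comp, fractPt_of_mem h3, ← h2]
    rw [abs_le] at h1
    rw [min_eq_right h1.2, max_eq_right h1.1]

/-! ### Averages along a segment -/

/-- The mean of `ψ` over the segment from `x - v` to `x`. -/
def segmentMean (ψ : ℝ × ℝ → ℝ) (v x : ℝ × ℝ) : ℝ := ∫ s in (0 : ℝ)..1, ψ (x - s • v)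

/-- The mean is a convolution in s, evaluated at 0, of the indicator of (0, 1] with u ↦ ψ(x + u v),
where x is a parameter. The cutoff χ, equal to 1 on [-1, 1], supplies compact support without
changing the value. -/
theorem contDiff_segmentMean {ψ : ℝ × ℝ → ℝ} (hψ : ContDiff ℝ ∞ ψ) (v : ℝ × ℝ) :
    ContDiff ℝ ∞ (segmentMean ψ v) := by
  let χ : ContDiffBump (0 : ℝ) := ⟨1, 2, one_pos, one_lt_two⟩
  have hχ : ContDiff ℝ ∞ χ := χ.contDiff
  have key := contDiffOn_convolution_right_with_param_comp (𝕜 := ℝ) (n := ⊤) (μ := volume)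
    (ContinuousLinearMap.mul ℝ ℝ) (s := univ) (v := fun _ : ℝ × ℝ => (0 : ℝ)) contDiffOn_const
    (f := (Ioc (0 : ℝ) 1).indicator fun _ => (1 : ℝ))
    (g := fun p u => χ u * ψ (p + u • v)) (k := tsupport χ) isOpen_univ χ.hasCompactSupport
    (fun p x _ hx => by simp [image_eq_zero_of_notMem_tsupport hx])
    ((integrable_indicator_iff measurableSet_Ioc).2
      (integrableOn_const (by simp))).locallyIntegrable
    (by
      refine ContDiff.contDiffOn ?_
      exact (hχ.comp contDiff_snd).mul
        (hψ.comp (contDiff_fst.add (contDiff_snd.smul contDiff_const))))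
  rw [contDiffOn_univ] at key
  convert key using 1
  funext x
  rw [segmentMean, intervalIntegral.integral_of_le zero_le_one, convolution_def,
    ← integral_indicator measurableSet_Ioc]
  congr 1
  funext s
  by_cases hs : s ∈ Ioc (0 : ℝ) 1
  · have h1 : χ (0 - s) = 1 := by
      apply χ.one_of_mem_closedBall
      rw [mem_closedBall_zero_iff, Real.norm_eq_abs, abs_le]
      exact ⟨by simpa [χ] using hs.2, by simp [χ]; linarith [hs.1]⟩
    simp only [indicator_of_mem hs, ContinuousLinearMap.mul_apply', one_mul, h1]
    rw [zero_sub, neg_smul, sub_eq_add_neg]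
  · simp [indicator_of_notMem hs]

/-- Along the line u ↦ x + u v the mean is the integral of r ↦ ψ(x + r v) over [u - 1, u], so the
fundamental theorem of calculus applies at both endpoints. -/
theorem fderiv_segmentMean {ψ : ℝ × ℝ → ℝ} (hψ : ContDiff ℝ ∞ ψ) (v x : ℝ × ℝ) :
    fderiv ℝ (segmentMean ψ v) x v = ψ x - ψ (x - v) := by
  have hd : DifferentiableAt ℝ (segmentMean ψ v) x :=
    (contDiff_segmentMean hψ v).differentiable (by simp) x
  rw [← hd.lineDeriv_eq_fderiv]
  apply HasLineDerivAt.lineDeriv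
  have hc : Continuous fun r : ℝ => ψ (x + r • v) := hψ.continuous.comp (by fun_prop)
  have hF : ∀ u : ℝ, HasDerivAt (fun u => ∫ r in (0 : ℝ)..u, ψ (x + r • v)) (ψ (x + u • v)) u :=
    fun u => intervalIntegral.integral_hasDerivAt_right (hc.intervalIntegrable _ _)
      hc.stronglyMeasurable.stronglyMeasurableAtFilter hc.continuousAt
  have hF2 := (hF (0 - 1)).comp_sub_const (0 : ℝ) 1
  have hG := (hF 0).sub hF2
  have e : (fun u : ℝ => segmentMean ψ v (x + u • v)) =
      (fun u => ∫ r in (0 : ℝ)..u, ψ (x + r • v)) -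
        fun u => ∫ r in (0 : ℝ)..(u - 1), ψ (x + r • v) := by
    funext u
    simp only [Pi.sub_apply]
    rw [intervalIntegral.integral_interval_sub_left (hc.intervalIntegrable _ _)
      (hc.intervalIntegrable _ _)]
    have := intervalIntegral.integral_comp_sub_left (a := 0) (b := 1)
      (fun r : ℝ => ψ (x + r • v)) u
    rw [sub_zero] at this
    rw [← this, segmentMean]
    congr 1
    funext s
    congr 1
    rw [sub_smul, add_sub_assoc]
  rw [HasLineDerivAt, e]
  convert hG using 1
  simp [sub_eq_add_neg]

theorem IsPeriodic.segmentMean {ψ : ℝ × ℝ → ℝ} (hψ : IsPeriodic ψ) (v : ℝ × ℝ) :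
    IsPeriodic (segmentMean ψ v) := by
  constructor <;> intro x <;> unfold PeriodicBV.segmentMean <;> congr 1 <;> funext s <;>
    rw [add_sub_right_comm]
  exacts [hψ.1 _, hψ.2 _]

theorem abs_segmentMean_le {ψ : ℝ × ℝ → ℝ} (hψ : ∀ x, |ψ x| ≤ 1) (v x : ℝ × ℝ) :
    |segmentMean ψ v x| ≤ 1 := by
  have := intervalIntegral.norm_integral_le_of_norm_le_const (a := 0) (b := 1) (C := 1)
    (f := fun s => ψ (x - s • v)) fun s _ => hψ _
  rwa [sub_zero, abs_one, mul_one, Real.norm_eq_abs] at this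

/-! ### Translation estimate for functions of bounded variation -/

theorem abs_signedIntegral_le {ψ : ℝ × ℝ → ℝ} {C : ℝ} (hψ : ∀ x, |ψ x| ≤ C)
    (μ : SignedMeasure (ℝ × ℝ)) :
    |signedIntegral ψ μ| ≤ C * (μ.totalVariation unitSquare).toReal := by
  have h1 : |∫ x in unitSquare, ψ x ∂μ.toJordanDecomposition.posPart| ≤
      C * (μ.toJordanDecomposition.posPart unitSquare).toReal := by
    rw [← Real.norm_eq_abs]
    exact norm_setIntegral_le_of_norm_le_const (measure_lt_top _ _) fun x _ => hψ x
  have h2 : |∫ x in unitSquare, ψ x ∂μ.toJordanDecomposition.negPart| ≤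
      C * (μ.toJordanDecomposition.negPart unitSquare).toReal := by
    rw [← Real.norm_eq_abs]
    exact norm_setIntegral_le_of_norm_le_const (measure_lt_top _ _) fun x _ => hψ x
  rw [SignedMeasure.totalVariation, Measure.add_apply,
    ENNReal.toReal_add (measure_ne_top _ _) (measure_ne_top _ _), mul_add]
  exact (abs_sub _ _).trans (add_le_add h1 h2)

theorem integrableOn_unitSquare_of_bounded {f : ℝ × ℝ → ℝ} (hf : Measurable f) {C : ℝ}
    (hC : ∀ x, |f x| ≤ C) : IntegrableOn f unitSquare :=
  Integrable.of_bound hf.aestronglyMeasurable C (Eventually.of_forall hC)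

theorem IsDistribDeriv.integral_translate_sub_mul_le {f : ℝ × ℝ → ℝ} (hper : IsPeriodic f)
    (hf : Measurable f) {C : ℝ} (hC : ∀ x, |f x| ≤ C) {v : ℝ × ℝ} {μ : SignedMeasure (ℝ × ℝ)}
    (hμ : IsDistribDeriv f v μ) (t : ℝ) {ψ : ℝ × ℝ → ℝ} (hψ : ContDiff ℝ ∞ ψ)
    (hψp : IsPeriodic ψ) (hψ1 : ∀ x, |ψ x| ≤ 1) :
    ∫ x in unitSquare, (f (x + t • v) - f x) * ψ x ≤
      |t| * (μ.totalVariation unitSquare).toReal := by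
  have hψm : Measurable ψ := hψ.continuous.measurable
  have hbound : ∀ (x y : ℝ × ℝ), |f x * ψ y| ≤ C := fun x y => by
    rw [abs_mul]
    exact (mul_le_of_le_one_right (abs_nonneg _) (hψ1 y)).trans (hC x)
  have i1 : IntegrableOn (fun x => f (x + t • v) * ψ x) unitSquare :=
    integrableOn_unitSquare_of_bounded ((hf.comp (measurable_add_const _)).mul hψm)
      fun x => hbound _ _
  have i2 : IntegrableOn (fun x => f x * ψ x) unitSquare :=
    integrableOn_unitSquare_of_bounded (hf.mul hψm) fun x => hbound _ _
  have i3 : IntegrableOn (fun x => f x * ψ (x - t • v)) unitSquare :=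
    integrableOn_unitSquare_of_bounded (hf.mul (hψm.comp (measurable_sub_const _)))
      fun x => hbound _ _
  have hp : IsPeriodic fun x => f (x + t • v) * ψ x := by
    constructor <;> intro x
    · exact congrArg₂ _ ((hper.comp_add _).1 x) (hψp.1 x)
    · exact congrArg₂ _ ((hper.comp_add _).2 x) (hψp.2 x)
  have e1 : ∫ x in unitSquare, f (x + t • v) * ψ x = ∫ x in unitSquare, f x * ψ (x - t • v) := by
    rw [← hp.setIntegral_add (-(t • v))]
    simp only [neg_add_cancel_right, sub_eq_add_neg]
  -- A periodic primitive of ψ - ψ(· - t v) in the direction v, bounded by |t|; the factor t in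
  -- front avoids dividing by t when t = 0.
  set Ψ : ℝ × ℝ → ℝ := fun x => t * segmentMean ψ (t • v) x with hΨ
  have hsm := contDiff_segmentMean hψ (t • v)
  have hder : ∀ x, fderiv ℝ Ψ x v = ψ x - ψ (x - t • v) := fun x => by
    rw [hΨ, fderiv_const_mul (hsm.differentiable (by simp) x), ← fderiv_segmentMean hψ (t • v) x]
    simp
  have hΨp : IsPeriodic Ψ :=
    ⟨fun x => congrArg (t * ·) ((hψp.segmentMean (t • v)).1 x),
      fun x => congrArg (t * ·) ((hψp.segmentMean (t • v)).2 x)⟩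
  have h := hμ Ψ (contDiff_const.mul hsm) hΨp
  simp only [hder] at h
  have hΨb : ∀ x, |Ψ x| ≤ |t| := fun x => by
    rw [hΨ, abs_mul]
    exact mul_le_of_le_one_right (abs_nonneg _) (abs_segmentMean_le hψ1 _ _)
  calc ∫ x in unitSquare, (f (x + t • v) - f x) * ψ x
      = (∫ x in unitSquare, f (x + t • v) * ψ x) - ∫ x in unitSquare, f x * ψ x := by
        rw [← integral_sub i1 i2]; simp only [sub_mul]
    _ = -∫ x in unitSquare, f x * (ψ x - ψ (x - t • v)) := by
        simp only [mul_sub]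
        rw [e1, integral_sub i2 i3, neg_sub]
    _ = signedIntegral Ψ μ := by rw [h, neg_neg]
    _ ≤ _ := (le_abs_self _).trans (abs_signedIntegral_le hΨb μ)

/-- Mollification: convolving with a probability density keeps periodicity and the bound 1. -/
theorem exists_smooth_periodic_tendsto {s : ℝ × ℝ → ℝ} (hs : Measurable s) (hp : IsPeriodic s)
    (hs1 : ∀ x, |s x| ≤ 1) :
    ∃ ψ : ℕ → ℝ × ℝ → ℝ, (∀ n, ContDiff ℝ ∞ (ψ n)) ∧ (∀ n, IsPeriodic (ψ n)) ∧
      (∀ n x, |ψ n x| ≤ 1) ∧ ∀ᵐ x, Tendsto (fun n => ψ n x) atTop (𝓝 (s x)) := by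
  have hpos : ∀ n : ℕ, (0 : ℝ) < 1 / ((n : ℝ) + 1) := fun n => Nat.one_div_pos_of_nat
  let φ : ℕ → ContDiffBump (0 : ℝ × ℝ) := fun n =>
    ⟨1 / ((n : ℝ) + 1), 2 * (1 / ((n : ℝ) + 1)), hpos n, by linarith [hpos n]⟩
  have hl : LocallyIntegrable s volume :=
    (locallyIntegrable_const (1 : ℝ)).mono hs.aestronglyMeasurable
      (Eventually.of_forall fun x => by simpa using hs1 x)
  refine ⟨fun n => convolution ((φ n).normed volume) s (ContinuousLinearMap.lsmul ℝ ℝ) volume,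
    fun n => ?_, fun n => ?_, fun n x => ?_, ?_⟩
  · exact ((φ n).hasCompactSupport_normed).contDiff_convolution_left (n := ⊤) _
      ((φ n).contDiff_normed) hl
  · constructor <;> intro x <;> simp only [convolution_def] <;> congr 1 <;> funext t <;>
      rw [add_sub_right_comm]
    exacts [congrArg _ (hp.1 _), congrArg _ (hp.2 _)]
  · dsimp only
    rw [convolution_def, ← (φ n).integral_normed (μ := volume), ← Real.norm_eq_abs]
    refine norm_integral_le_of_norm_le (φ n).integrable_normed (Eventually.of_forall fun t => ?_)
    have h0 := (φ n).nonneg_normed (μ := volume) t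
    rw [ContinuousLinearMap.lsmul_apply, smul_eq_mul, norm_mul, Real.norm_of_nonneg h0]
    exact mul_le_of_le_one_right h0 (hs1 _)
  -- Lebesgue differentiation; `K` bounds the ratio of outer to inner radius, which is exactly 2
  -- here.
  · refine ContDiffBump.ae_convolution_tendsto_right_of_locallyIntegrable (K := 2) ?_
      (Eventually.of_forall fun n => le_rfl) hl
    have h := (tendsto_one_div_add_atTop_nhds_zero_nat (𝕜 := ℝ)).const_mul 2
    rwa [mul_zero] at h

/-- L¹–L^∞ duality with smooth test functions: mollifications of the sign of g are admissible, and
dominated convergence recovers ∫ |g|. -/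
theorem lintegral_enorm_le_of_forall_integral_mul_le {g : ℝ × ℝ → ℝ} (hp : IsPeriodic g)
    (hg : Measurable g) {C : ℝ} (hC : ∀ x, |g x| ≤ C) {K : ℝ}
    (hK : ∀ ψ : ℝ × ℝ → ℝ, ContDiff ℝ ∞ ψ → IsPeriodic ψ → (∀ x, |ψ x| ≤ 1) →
      ∫ x in unitSquare, g x * ψ x ≤ K) :
    ∫⁻ x in unitSquare, ‖g x‖ₑ ≤ ENNReal.ofReal K := by
  set σ : ℝ → ℝ := fun y => if 0 ≤ y then 1 else -1 with hσ
  have hσm : Measurable σ := Measurable.ite measurableSet_Ici measurable_const measurable_const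
  have hσ1 : ∀ y, |σ y| ≤ 1 := fun y => by rw [hσ]; dsimp only; split_ifs <;> simp
  have hσy : ∀ y, y * σ y = |y| := fun y => by
    rw [hσ]; dsimp only
    split_ifs with h
    · rw [mul_one, abs_of_nonneg h]
    · rw [mul_neg_one, abs_of_neg (not_le.1 h)]
  obtain ⟨ψ, h1, h2, h3, h4⟩ := exists_smooth_periodic_tendsto (hσm.comp hg)
    ⟨fun x => congrArg σ (hp.1 x), fun x => congrArg σ (hp.2 x)⟩ fun x => hσ1 _
  have lim : Tendsto (fun n => ∫ x in unitSquare, g x * ψ n x) atTop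
      (𝓝 (∫ x in unitSquare, ‖g x‖)) := by
    refine tendsto_integral_of_dominated_convergence (fun _ => C) (fun n =>
      (hg.mul (h1 n).continuous.measurable).aestronglyMeasurable) (integrable_const C)
      (fun n => Eventually.of_forall fun x => ?_) ?_
    · rw [norm_mul]
      exact (mul_le_of_le_one_right (norm_nonneg _) (h3 n x)).trans (hC x)
    · filter_upwards [ae_restrict_of_ae h4] with x hx
      rw [Real.norm_eq_abs, ← hσy]
      exact hx.const_mul _
  rw [← ofReal_integral_norm_eq_lintegral_enorm (integrableOn_unitSquare_of_bounded hg hC)]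
  exact ENNReal.ofReal_le_ofReal (le_of_tendsto' lim fun n => hK _ (h1 n) (h2 n) (h3 n))

theorem IsDistribDeriv.lintegral_translate_sub_le {f : ℝ × ℝ → ℝ} (hper : IsPeriodic f)
    (hf : Measurable f) {C : ℝ} (hC : ∀ x, |f x| ≤ C) {v : ℝ × ℝ} {μ : SignedMeasure (ℝ × ℝ)}
    (hμ : IsDistribDeriv f v μ) (t : ℝ) :
    ∫⁻ x in unitSquare, ‖f (x + t • v) - f x‖ₑ ≤
      ENNReal.ofReal |t| * μ.totalVariation unitSquare := by
  have hfin : μ.totalVariation unitSquare ≠ ⊤ := by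
    rw [SignedMeasure.totalVariation, Measure.add_apply]
    exact ENNReal.add_ne_top.2 ⟨measure_ne_top _ _, measure_ne_top _ _⟩
  rw [← ENNReal.ofReal_toReal hfin, ← ENNReal.ofReal_mul (abs_nonneg t)]
  refine lintegral_enorm_le_of_forall_integral_mul_le (C := C + C) ?_
    ((hf.comp (measurable_add_const _)).sub hf)
    (fun x => (abs_sub _ _).trans (add_le_add (hC _) (hC _)))
    fun ψ h1 h2 h3 => hμ.integral_translate_sub_mul_le hper hf hC t h1 h2 h3
  exact ⟨fun x => congrArg₂ (· - ·) ((hper.comp_add _).1 x) (hper.1 x),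
    fun x => congrArg₂ (· - ·) ((hper.comp_add _).2 x) (hper.2 x)⟩

/-! ### The periodized splines form a partition of unity -/

theorem B₂_nonneg (t : ℝ) : 0 ≤ B₂ t := le_max_right _ _

theorem abs_lt_one_of_B₂_ne_zero {t : ℝ} (h : B₂ t ≠ 0) : |t| < 1 := by
  by_contra! h'
  exact h (max_eq_right (by linarith))

/-- Only the nodes ⌊t⌋ and ⌊t⌋ + 1 contribute, with weights 1 - fract t and fract t. -/
theorem hasSum_B₂_sub_int (t : ℝ) : HasSum (fun n : ℤ => B₂ (t - n)) 1 := by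
  have h0 := Int.fract_nonneg t
  have h1 := Int.fract_lt_one t
  have ht := Int.floor_add_fract t
  have hs : ∑ n ∈ ({⌊t⌋, ⌊t⌋ + 1} : Finset ℤ), B₂ (t - n) = 1 := by
    rw [Finset.sum_pair (by omega)]
    have e0 : t - (⌊t⌋ : ℤ) = Int.fract t := rfl
    have e1 : t - ((⌊t⌋ + 1 : ℤ) : ℝ) = Int.fract t - 1 := by push_cast; linarith
    rw [e0, e1, B₂, B₂, abs_of_nonneg h0, abs_of_neg (by linarith), max_eq_left (by linarith),
      max_eq_left (by linarith)]
    ring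
  rw [← hs]
  refine hasSum_sum_of_ne_finset_zero fun n hn => ?_
  by_contra h
  have h' := abs_lt.1 (abs_lt_one_of_B₂_ne_zero h)
  apply hn
  have a1 : (⌊t⌋ : ℝ) < n + 1 := by linarith [h'.2]
  have a2 : (n : ℝ) < ⌊t⌋ + 1 + 1 := by linarith [h'.1]
  have b1 : ⌊t⌋ < n + 1 := by exact_mod_cast a1
  have b2 : n < ⌊t⌋ + 1 + 1 := by exact_mod_cast a2
  simp only [Finset.mem_insert, Finset.mem_singleton]
  omega

/-- The one-dimensional periodized spline with `N` nodes per period. -/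
def splinePer (N : ℕ) (k : ℕ) (t : ℝ) : ℝ := ∑' m : ℤ, B₂ (t - k + N * m)

theorem summable_splinePer {N : ℕ} (hN : N ≠ 0) (k : ℕ) (t : ℝ) :
    Summable fun m : ℤ => B₂ (t - k + N * m) := by
  have hinj : Function.Injective fun m : ℤ => (k : ℤ) - N * m := fun a b h => by
    have : (N : ℤ) * a = N * b := by simpa using h
    exact mul_left_cancel₀ (by exact_mod_cast hN) this
  have := (hasSum_B₂_sub_int t).summable.comp_injective hinj
  refine this.congr fun m => ?_
  simp only [Function.comp]
  push_cast
  congr 1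
  ring

theorem sum_splinePer {N : ℕ} (hN : N ≠ 0) (t : ℝ) :
    ∑ k ∈ Finset.range N, splinePer N k t = 1 := by
  have : NeZero N := ⟨hN⟩
  -- Split the integer nodes by residue k modulo N. The quotient is then negated because the
  -- periodization places its nodes at k - N m.
  have h := ((Int.divModEquiv N).symm.hasSum_iff.2 (hasSum_B₂_sub_int t))
  have h2 := ((Equiv.neg ℤ).prodCongr (Equiv.refl (Fin N))).hasSum_iff.2 h
  have h3 := (Equiv.prodComm (Fin N) ℤ).hasSum_iff.2 h2
  have h4 := h3.prod_fiberwise (g := fun k : Fin N => splinePer N k t) fun k => by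
    have := (summable_splinePer hN (k : ℕ) t).hasSum
    convert this using 2 with m
    · simp [Int.divModEquiv]
      congr 1
      ring
    · rfl
  rw [Finset.sum_range]
  exact (hasSum_fintype _).unique h4

theorem phiPer_eq (J : ℕ) (k : ℕ × ℕ) (x : ℝ × ℝ) :
    phiPer J k x = splinePer (2 ^ J) k.1 (2 ^ J * x.1) * splinePer (2 ^ J) k.2 (2 ^ J * x.2) := by
  have hN : 2 ^ J ≠ 0 := by positivity
  have h1 := (summable_splinePer hN k.1 (2 ^ J * x.1))
  have h2 := (summable_splinePer hN k.2 (2 ^ J * x.2))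
  rw [splinePer, splinePer, tsum_mul_tsum_of_summable_norm h1.norm h2.norm]
  simp [phiPer, phi]

theorem phiPer_nonneg (J : ℕ) (k : ℕ × ℕ) (x : ℝ × ℝ) : 0 ≤ phiPer J k x :=
  tsum_nonneg fun _ => mul_nonneg (B₂_nonneg _) (B₂_nonneg _)

theorem sum_phiPer (J : ℕ) (x : ℝ × ℝ) :
    ∑ k ∈ Finset.range (2 ^ J) ×ˢ Finset.range (2 ^ J), phiPer J k x = 1 := by
  have hN : 2 ^ J ≠ 0 := by positivity
  simp only [phiPer_eq, Finset.sum_product]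
  rw [← Finset.sum_mul_sum, sum_splinePer hN, sum_splinePer hN, one_mul]

theorem exists_of_phiPer_ne_zero {J : ℕ} {k : ℕ × ℕ} {x : ℝ × ℝ} (h : phiPer J k x ≠ 0) :
    ∃ m n : ℤ, |2 ^ J * x.1 - k.1 + 2 ^ J * m| < 1 ∧ |2 ^ J * x.2 - k.2 + 2 ^ J * n| < 1 := by
  by_contra! hc
  apply h
  rw [phiPer, ← tsum_zero (β := ℤ × ℤ)]
  congr 1
  funext m
  by_contra hm
  have := mul_ne_zero_iff.1 hm
  exact (hc m.1 m.2 (abs_lt_one_of_B₂_ne_zero this.1)).not_gt (abs_lt_one_of_B₂_ne_zero this.2)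

/-! ### Local comparison of the samples with the function -/

/-- The dyadic cell of side `2 ^ (-J)` at `k`. -/
def cell (J : ℕ) (k : ℕ × ℕ) : Set (ℝ × ℝ) :=
  Ico ((2 : ℝ)⁻¹ ^ J * k.1) ((2 : ℝ)⁻¹ ^ J * (k.1 + 1)) ×ˢ
    Ico ((2 : ℝ)⁻¹ ^ J * k.2) ((2 : ℝ)⁻¹ ^ J * (k.2 + 1))

theorem measurableSet_cell (J : ℕ) (k : ℕ × ℕ) : MeasurableSet (cell J k) :=
  measurableSet_Ico.prod measurableSet_Ico

theorem volume_cell (J : ℕ) (k : ℕ × ℕ) :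
    volume (cell J k) = ENNReal.ofReal ((2 : ℝ)⁻¹ ^ J * (2 : ℝ)⁻¹ ^ J) := by
  rw [cell, Measure.volume_eq_prod, Measure.prod_prod, Real.volume_Ico, Real.volume_Ico,
    ← ENNReal.ofReal_mul (by rw [← mul_sub]; simp)]
  congr 1
  ring

theorem two_pow_mul_inv_pow (J : ℕ) : (2 : ℝ) ^ J * (2 : ℝ)⁻¹ ^ J = 1 := by
  rw [← mul_pow]; norm_num

theorem mem_Ico_scale_iff (J k : ℕ) (t : ℝ) :
    2 ^ J * t - k ∈ Ico (0 : ℝ) 1 ↔ t ∈ Ico ((2 : ℝ)⁻¹ ^ J * k) ((2 : ℝ)⁻¹ ^ J * (k + 1)) := by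
  have h : (0 : ℝ) < 2 ^ J := by positivity
  simp only [mem_Ico, inv_pow, inv_mul_le_iff₀ h, lt_inv_mul_iff₀ h, sub_nonneg,
    sub_lt_iff_lt_add']

theorem cell_subset_unitSquare {J : ℕ} {k : ℕ × ℕ} (h1 : k.1 < 2 ^ J) (h2 : k.2 < 2 ^ J) :
    cell J k ⊆ unitSquare := by
  have key : ∀ n : ℕ, n < 2 ^ J →
      Ico ((2 : ℝ)⁻¹ ^ J * n) ((2 : ℝ)⁻¹ ^ J * (n + 1)) ⊆ Ico (0 : ℝ) 1 := fun n hn => by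
    have hn' : (n : ℝ) + 1 ≤ 2 ^ J := by exact_mod_cast hn
    apply Ico_subset_Ico (by positivity)
    calc (2 : ℝ)⁻¹ ^ J * (n + 1) ≤ (2 : ℝ)⁻¹ ^ J * 2 ^ J := by gcongr
      _ = 1 := by rw [mul_comm, two_pow_mul_inv_pow]
  exact prod_mono (key _ h1) (key _ h2)

theorem sample_eq_setIntegral_cell (g : ℝ × ℝ → ℝ) {J : ℕ} {k : ℕ × ℕ} (h1 : k.1 < 2 ^ J)
    (h2 : k.2 < 2 ^ J) : sample g J k = 2 ^ J * 2 ^ J * ∫ y in cell J k, g y := by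
  have e : (fun x => g x * boxFun J k x) = (cell J k).indicator fun x => 2 ^ J * g x := by
    funext x
    have hx : ((2 ^ J * x.1 - k.1, 2 ^ J * x.2 - k.2) : ℝ × ℝ) ∈ unitSquare ↔ x ∈ cell J k :=
      and_congr (mem_Ico_scale_iff J k.1 x.1) (mem_Ico_scale_iff J k.2 x.2)
    by_cases h : x ∈ cell J k
    · rw [boxFun, indicator_of_mem (hx.2 h), indicator_of_mem h]; ring
    · rw [boxFun, indicator_of_notMem (mt hx.1 h), indicator_of_notMem h]; ring
  rw [sample, e, setIntegral_indicator (measurableSet_cell J k),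
    inter_eq_self_of_subset_right (cell_subset_unitSquare h1 h2), integral_const_mul, mul_assoc]

theorem sample_congr {f g : ℝ × ℝ → ℝ} (h : f =ᵐ[volume.restrict unitSquare] g) (J : ℕ)
    (k : ℕ × ℕ) : sample f J k = sample g J k := by
  rw [sample, sample]
  congr 1
  apply integral_congr_ae
  filter_upwards [h] with x hx
  rw [hx]

theorem IsDistribDeriv.congr {f g : ℝ × ℝ → ℝ} (h : f =ᵐ[volume.restrict unitSquare] g)
    {v : ℝ × ℝ} {μ : SignedMeasure (ℝ × ℝ)} (hf : IsDistribDeriv f v μ) :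
    IsDistribDeriv g v μ := fun ψ h1 h2 => by
  rw [← hf ψ h1 h2]
  apply integral_congr_ae
  filter_upwards [h] with x hx
  rw [hx]

theorem sample_sub_eq {g : ℝ × ℝ → ℝ} (hg : Measurable g) {C : ℝ} (hC : ∀ x, |g x| ≤ C) {J : ℕ}
    {k : ℕ × ℕ} (h1 : k.1 < 2 ^ J) (h2 : k.2 < 2 ^ J) (a : ℝ) :
    sample g J k - a = 2 ^ J * 2 ^ J * ∫ y in cell J k, (g y - a) := by
  have hi : IntegrableOn g (cell J k) :=
    (integrableOn_unitSquare_of_bounded hg hC).mono_set (cell_subset_unitSquare h1 h2)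
  have hv : volume (cell J k) ≠ ⊤ := by rw [volume_cell]; exact ENNReal.ofReal_ne_top
  rw [integral_sub hi (integrableOn_const hv), setIntegral_const, Measure.real, volume_cell,
    ENNReal.toReal_ofReal (by positivity), sample_eq_setIntegral_cell g h1 h2, smul_eq_mul]
  linear_combination (a * (2 ^ J * 2⁻¹ ^ J) + a) * two_pow_mul_inv_pow J

theorem abs_sample_sub_le {g : ℝ × ℝ → ℝ} (hg : Measurable g) {C : ℝ} (hC : ∀ x, |g x| ≤ C)
    {J : ℕ} {k : ℕ × ℕ} (h1 : k.1 < 2 ^ J) (h2 : k.2 < 2 ^ J) (x : ℝ × ℝ) :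
    |sample g J k - g x| ≤ 2 * C := by
  have hv : volume (cell J k) < ⊤ := by rw [volume_cell]; exact ENNReal.ofReal_lt_top
  have h := norm_setIntegral_le_of_norm_le_const (C := 2 * C) (f := fun y => g y - g x) hv
    fun y _ => (abs_sub _ _).trans (by linarith [hC y, hC x])
  rw [Measure.real, volume_cell, ENNReal.toReal_ofReal (by positivity), Real.norm_eq_abs] at h
  rw [sample_sub_eq hg hC h1 h2, abs_mul, abs_of_nonneg (by positivity)]
  calc 2 ^ J * 2 ^ J * |∫ y in cell J k, (g y - g x)|
      ≤ 2 ^ J * 2 ^ J * (2 * C * (2⁻¹ ^ J * 2⁻¹ ^ J)) := by gcongr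
    _ = 2 * C * ((2 ^ J * 2⁻¹ ^ J) * (2 ^ J * 2⁻¹ ^ J)) := by ring
    _ = 2 * C := by rw [two_pow_mul_inv_pow]; ring

/-- A square containing all displacements from a point to the cells whose spline is nonzero
there. -/
def window (J : ℕ) : Set (ℝ × ℝ) :=
  Icc (-(2 : ℝ)⁻¹ ^ J) (2 * (2 : ℝ)⁻¹ ^ J) ×ˢ Icc (-(2 : ℝ)⁻¹ ^ J) (2 * (2 : ℝ)⁻¹ ^ J)

/-- The mean oscillation of `g` around `x` at scale `2 ^ (-J)` (up to normalization). -/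
def oscillation (g : ℝ × ℝ → ℝ) (J : ℕ) (x : ℝ × ℝ) : ℝ≥0∞ :=
  ENNReal.ofReal (2 ^ J * 2 ^ J) * ∫⁻ z in window J, ‖g (x + z) - g x‖ₑ

/-- With h the mesh size, t + m is within h of the node hk, while the cell is [hk, hk + h); hence
the asymmetric range from -h to 2h. -/
theorem mem_window_of_add_mem {J k : ℕ} {t z : ℝ} {m : ℤ} (h : |2 ^ J * t - k + 2 ^ J * m| < 1)
    (hz : z + (t + m) ∈ Ico ((2 : ℝ)⁻¹ ^ J * k) ((2 : ℝ)⁻¹ ^ J * (k + 1))) :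
    z ∈ Icc (-(2 : ℝ)⁻¹ ^ J) (2 * (2 : ℝ)⁻¹ ^ J) := by
  have hp : (0 : ℝ) < 2⁻¹ ^ J := by positivity
  have hJ := two_pow_mul_inv_pow J
  obtain ⟨h1, h2⟩ := abs_lt.1 h
  have a1 := mul_lt_mul_of_pos_left h1 hp
  have a2 := mul_lt_mul_of_pos_left h2 hp
  have e : (2 : ℝ)⁻¹ ^ J * (2 ^ J * t - k + 2 ^ J * m) = t + m - 2⁻¹ ^ J * k := by
    linear_combination (t + m) * hJ
  rw [e] at a1 a2
  obtain ⟨h3, h4⟩ := hz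
  constructor <;> linarith

theorem enorm_sample_sub_le_oscillation {g : ℝ × ℝ → ℝ} (hp : IsPeriodic g) (hg : Measurable g)
    {C : ℝ} (hC : ∀ x, |g x| ≤ C) {J : ℕ} {k : ℕ × ℕ} (h1 : k.1 < 2 ^ J) (h2 : k.2 < 2 ^ J)
    {x : ℝ × ℝ} (hx : phiPer J k x ≠ 0) : ‖sample g J k - g x‖ₑ ≤ oscillation g J x := by
  obtain ⟨m, n, hm, hn⟩ := exists_of_phiPer_ne_zero hx
  rw [sample_sub_eq hg hC h1 h2, enorm_mul, oscillation,
    Real.enorm_of_nonneg (by positivity : (0 : ℝ) ≤ 2 ^ J * 2 ^ J)]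
  gcongr
  refine (enorm_integral_le_lintegral_enorm _).trans ?_
  -- Substitute y = z + x + (m, n), where (m, n) brings x next to the node; periodicity then removes
  -- (m, n) from the argument of g.
  rw [← (measurePreserving_add_right volume
    (x + ((m : ℝ), (n : ℝ)))).setLIntegral_comp_preimage_emb (measurableEmbedding_addRight _)]
  have e : ∀ z, g (z + (x + ((m : ℝ), (n : ℝ)))) = g (x + z) := fun z => by
    rw [← add_assoc, hp.add_int, add_comm]
  simp only [e]
  exact lintegral_mono_set fun z hz =>
    ⟨mem_window_of_add_mem hm hz.1, mem_window_of_add_mem hn hz.2⟩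

/-- Convexity of the weights `phiPer`. It serves twice, with D the oscillation and with D = 2M. -/
theorem enorm_interpolant_sub_le {g : ℝ × ℝ → ℝ} {J : ℕ} {x : ℝ × ℝ} {a : ℝ} {D : ℝ≥0∞}
    (h : ∀ k ∈ Finset.range (2 ^ J) ×ˢ Finset.range (2 ^ J), phiPer J k x ≠ 0 →
      ‖sample g J k - a‖ₑ ≤ D) :
    ‖interpolant g J x - a‖ₑ ≤ D := by
  have e : interpolant g J x - a =
      ∑ k ∈ Finset.range (2 ^ J) ×ˢ Finset.range (2 ^ J), phiPer J k x * (sample g J k - a) := by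
    simp only [mul_sub, Finset.sum_sub_distrib, ← Finset.sum_mul, sum_phiPer, one_mul,
      interpolant]
    simp only [mul_comm]
  rw [e]
  calc _ ≤ ∑ k ∈ Finset.range (2 ^ J) ×ˢ Finset.range (2 ^ J),
        ‖phiPer J k x * (sample g J k - a)‖ₑ := enorm_sum_le _ _
    _ ≤ ∑ k ∈ Finset.range (2 ^ J) ×ˢ Finset.range (2 ^ J), ENNReal.ofReal (phiPer J k x) * D := by
        refine Finset.sum_le_sum fun k hk => ?_
        rw [enorm_mul, Real.enorm_of_nonneg (phiPer_nonneg J k x)]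
        by_cases h0 : phiPer J k x = 0
        · simp [h0]
        · gcongr
          exact h k hk h0
    _ = D := by
        rw [← Finset.sum_mul, ← ENNReal.ofReal_sum_of_nonneg fun k _ => phiPer_nonneg J k x,
          sum_phiPer, ENNReal.ofReal_one, one_mul]

/-! ### Integrating the oscillation -/

theorem lintegral_abs_Icc {h : ℝ} (hh : 0 ≤ h) :
    ∫⁻ t in Icc (-h) (2 * h), ENNReal.ofReal |t| = ENNReal.ofReal (5 / 2 * h ^ 2) := by
  have hc : Continuous fun t : ℝ => |t| := continuous_abs
  rw [← ofReal_integral_eq_lintegral_ofReal (hc.continuousOn.integrableOn_Icc)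
    (Filter.Eventually.of_forall fun t => abs_nonneg t), integral_Icc_eq_integral_Ioc,
    ← intervalIntegral.integral_of_le (by linarith),
    ← intervalIntegral.integral_add_adjacent_intervals (b := 0) (hc.intervalIntegrable _ _)
      (hc.intervalIntegrable _ _)]
  have e1 : ∫ t in (-h)..0, |t| = ∫ t in (-h)..0, -t := by
    apply intervalIntegral.integral_congr
    intro t ht
    rw [uIcc_of_le (by linarith)] at ht
    exact abs_of_nonpos ht.2
  have e2 : ∫ t in (0 : ℝ)..(2 * h), |t| = ∫ t in (0 : ℝ)..(2 * h), t := by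
    apply intervalIntegral.integral_congr
    intro t ht
    rw [uIcc_of_le (by linarith)] at ht
    exact abs_of_nonneg ht.1
  rw [e1, e2, intervalIntegral.integral_neg, integral_id, integral_id]
  congr 1
  ring

theorem setLIntegral_window_mul (J : ℕ) {F G : ℝ → ℝ≥0∞} (hF : Measurable F) (hG : Measurable G) :
    ∫⁻ z in window J, F z.1 * G z.2 =
      (∫⁻ t in Icc (-(2 : ℝ)⁻¹ ^ J) (2 * (2 : ℝ)⁻¹ ^ J), F t) *
        ∫⁻ t in Icc (-(2 : ℝ)⁻¹ ^ J) (2 * (2 : ℝ)⁻¹ ^ J), G t := by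
  rw [window, Measure.volume_eq_prod, ← Measure.prod_restrict]
  exact lintegral_prod_mul hF.aemeasurable hG.aemeasurable

theorem setLIntegral_window_fst (J : ℕ) :
    ∫⁻ z in window J, ENNReal.ofReal |z.1| = ENNReal.ofReal (15 / 2 * (2⁻¹ ^ J) ^ 3) := by
  have h := setLIntegral_window_mul J (F := fun t => ENNReal.ofReal |t|) (G := fun _ => 1)
    (by fun_prop) measurable_const
  simp only [mul_one] at h
  rw [h, lintegral_abs_Icc (by positivity), setLIntegral_one, Real.volume_Icc,
    ← ENNReal.ofReal_mul (by positivity)]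
  congr 1
  ring

theorem setLIntegral_window_snd (J : ℕ) :
    ∫⁻ z in window J, ENNReal.ofReal |z.2| = ENNReal.ofReal (15 / 2 * (2⁻¹ ^ J) ^ 3) := by
  have h := setLIntegral_window_mul J (F := fun _ => 1) (G := fun t => ENNReal.ofReal |t|)
    measurable_const (by fun_prop)
  simp only [one_mul] at h
  rw [h, lintegral_abs_Icc (by positivity), setLIntegral_one, Real.volume_Icc,
    ← ENNReal.ofReal_mul (by rw [sub_neg_eq_add]; positivity)]
  congr 1
  ring

theorem lintegral_translate_sub_le {g : ℝ × ℝ → ℝ} (hp : IsPeriodic g) (hg : Measurable g) {C : ℝ}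
    (hC : ∀ x, |g x| ≤ C) {μ ν : SignedMeasure (ℝ × ℝ)} (hμ : IsDistribDeriv g (1, 0) μ)
    (hν : IsDistribDeriv g (0, 1) ν) (z : ℝ × ℝ) :
    ∫⁻ x in unitSquare, ‖g (x + z) - g x‖ₑ ≤
      ENNReal.ofReal |z.1| * μ.totalVariation unitSquare +
        ENNReal.ofReal |z.2| * ν.totalVariation unitSquare := by
  set u : ℝ × ℝ := z.1 • (1, 0) with hu
  set w : ℝ × ℝ := z.2 • (0, 1) with hw
  have hz : ∀ x, x + z = x + w + u := fun x => by
    ext <;> simp [hu, hw]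
  have hm : Measurable fun x => ‖g (x + u) - g x‖ₑ :=
    ((hg.comp (measurable_add_const u)).sub hg).enorm
  -- Go from x to x + z through x + w; by periodicity the horizontal increment based at x + w has
  -- the same integral as the one based at x.
  have e : ∫⁻ x in unitSquare, ‖g (x + w + u) - g (x + w)‖ₑ =
      ∫⁻ x in unitSquare, ‖g (x + u) - g x‖ₑ :=
    setLIntegral_add_of_periodic (F := fun x => ‖g (x + u) - g x‖ₑ)
      (fun m n x => by rw [add_right_comm, hp.add_int, hp.add_int]) w
  calc ∫⁻ x in unitSquare, ‖g (x + z) - g x‖ₑ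
      ≤ ∫⁻ x in unitSquare, (‖g (x + w + u) - g (x + w)‖ₑ + ‖g (x + w) - g x‖ₑ) := by
        refine lintegral_mono fun x => ?_
        rw [hz, ← sub_add_sub_cancel (g (x + w + u)) (g (x + w)) (g x)]
        exact enorm_add_le _ _
    _ = (∫⁻ x in unitSquare, ‖g (x + u) - g x‖ₑ) + ∫⁻ x in unitSquare, ‖g (x + w) - g x‖ₑ := by
        rw [← e]
        exact lintegral_add_left (hm.comp (measurable_add_const w)) _
    _ ≤ _ := add_le_add (hμ.lintegral_translate_sub_le hp hg hC _)
        (hν.lintegral_translate_sub_le hp hg hC _)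

theorem lintegral_oscillation_le {g : ℝ × ℝ → ℝ} (hp : IsPeriodic g) (hg : Measurable g) {C : ℝ}
    (hC : ∀ x, |g x| ≤ C) {μ ν : SignedMeasure (ℝ × ℝ)} (hμ : IsDistribDeriv g (1, 0) μ)
    (hν : IsDistribDeriv g (0, 1) ν) (J : ℕ) :
    ∫⁻ x in unitSquare, oscillation g J x ≤ ENNReal.ofReal (15 / 2 * 2⁻¹ ^ J) *
      (μ.totalVariation unitSquare + ν.totalVariation unitSquare) := by
  have hm : Measurable fun p : (ℝ × ℝ) × (ℝ × ℝ) => ‖g (p.1 + p.2) - g p.1‖ₑ :=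
    ((hg.comp (measurable_fst.add measurable_snd)).sub (hg.comp measurable_fst)).enorm
  unfold oscillation
  rw [lintegral_const_mul' _ _ ENNReal.ofReal_ne_top, lintegral_lintegral_swap hm.aemeasurable]
  calc _ ≤ ENNReal.ofReal (2 ^ J * 2 ^ J) * ∫⁻ z in window J,
        (ENNReal.ofReal |z.1| * μ.totalVariation unitSquare +
          ENNReal.ofReal |z.2| * ν.totalVariation unitSquare) := by
        gcongr with z
        exact lintegral_translate_sub_le hp hg hC hμ hν z
    _ = ENNReal.ofReal (2 ^ J * 2 ^ J) * (ENNReal.ofReal (15 / 2 * (2⁻¹ ^ J) ^ 3) *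
        (μ.totalVariation unitSquare + ν.totalVariation unitSquare)) := by
        rw [lintegral_add_left (by fun_prop), lintegral_mul_const _ (by fun_prop),
          lintegral_mul_const _ (by fun_prop), setLIntegral_window_fst, setLIntegral_window_snd,
          ← mul_add]
    _ = _ := by
        rw [← mul_assoc, ← ENNReal.ofReal_mul (by positivity)]
        congr 2
        have := two_pow_mul_inv_pow J
        linear_combination (15 / 2 * 2⁻¹ ^ J * (2 ^ J * 2⁻¹ ^ J + 1)) * this

/-! ### Assembling the estimate. -/

theorem IsBV.isDistribDeriv_fst {f : ℝ × ℝ → ℝ} (hf : IsBV f) :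
    IsDistribDeriv f (1, 0) (derivMeasure f (1, 0)) := by
  rw [derivMeasure, dif_pos hf.2.1]
  exact hf.2.1.choose_spec

theorem IsBV.isDistribDeriv_snd {f : ℝ × ℝ → ℝ} (hf : IsBV f) :
    IsDistribDeriv f (0, 1) (derivMeasure f (0, 1)) := by
  rw [derivMeasure, dif_pos hf.2.2]
  exact hf.2.2.choose_spec

end PeriodicBV

end

theorem theorem5 (f : ℝ × ℝ → ℝ) (hper : PeriodicBV.IsPeriodic f) (hBV : PeriodicBV.IsBV f)
    (hbdd : MemLp f ∞ (volume.restrict PeriodicBV.unitSquare)) (J : ℕ) :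
    eLpNorm (fun x => PeriodicBV.interpolant f J x - f x) 2
        (volume.restrict PeriodicBV.unitSquare) ^ 2 ≤
      ENNReal.ofReal ((16 + 4 * Real.sqrt Real.pi) * (2 : ℝ)⁻¹ ^ J) * PeriodicBV.TV f *
        eLpNorm f ∞ (volume.restrict PeriodicBV.unitSquare) := by
  open PeriodicBV in
  obtain ⟨g, hp, hg, hC, hfg⟩ := exists_measurable_bounded_periodic hbdd
  set M := (eLpNorm f ∞ (volume.restrict unitSquare)).toReal with hM
  have hM0 : 0 ≤ M := ENNReal.toReal_nonneg
  -- The measures chosen for f are also derivatives of g, so the bounds for g come out directly in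
  -- terms of `TV f`.
  have hμ := hBV.isDistribDeriv_fst.congr hfg
  have hν := hBV.isDistribDeriv_snd.congr hfg
  have hfg' : (fun x => interpolant f J x - f x) =ᵐ[volume.restrict unitSquare]
      fun x => interpolant g J x - g x := by
    filter_upwards [hfg] with x hx
    simp only [interpolant, sample_congr hfg, hx]
  have hosc : ∀ x, ‖interpolant g J x - g x‖ₑ ≤ oscillation g J x := fun x =>
    enorm_interpolant_sub_le fun k hk h0 => by
      rw [Finset.mem_product, Finset.mem_range, Finset.mem_range] at hk
      exact enorm_sample_sub_le_oscillation hp hg hC hk.1 hk.2 h0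
  have hbd : ∀ x, ‖interpolant g J x - g x‖ₑ ≤ ENNReal.ofReal (2 * M) := fun x =>
    enorm_interpolant_sub_le fun k hk _ => by
      rw [Finset.mem_product, Finset.mem_range, Finset.mem_range] at hk
      rw [Real.enorm_eq_ofReal_abs]
      exact ENNReal.ofReal_le_ofReal (abs_sample_sub_le hg hC hk.1 hk.2 x)
  have hsq : eLpNorm (fun x => interpolant f J x - f x) 2 (volume.restrict unitSquare) ^ 2 =
      ∫⁻ x in unitSquare, ‖interpolant g J x - g x‖ₑ ^ 2 := by
    rw [eLpNorm_congr_ae hfg']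
    have := eLpNorm_nnreal_pow_eq_lintegral (μ := volume.restrict unitSquare) (p := 2)
      (f := fun x => interpolant g J x - g x) two_ne_zero
    simpa using this
  rw [hsq]
  calc ∫⁻ x in unitSquare, ‖interpolant g J x - g x‖ₑ ^ 2
      ≤ ∫⁻ x in unitSquare, ENNReal.ofReal (2 * M) * oscillation g J x := by
        refine lintegral_mono fun x => ?_
        rw [sq]
        -- One factor takes the uniform bound, the other the oscillation: this product yields the
        -- first power of both M and TV.
        exact mul_le_mul' (hbd x) (hosc x)
    _ ≤ ENNReal.ofReal (2 * M) * (ENNReal.ofReal (15 / 2 * 2⁻¹ ^ J) * TV f) := by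
        rw [lintegral_const_mul' _ _ ENNReal.ofReal_ne_top]
        gcongr
        exact lintegral_oscillation_le hp hg hC hμ hν J
    _ = ENNReal.ofReal (15 * 2⁻¹ ^ J) * TV f * ENNReal.ofReal M := by
        have : (15 : ℝ) * 2⁻¹ ^ J = 2 * (15 / 2 * 2⁻¹ ^ J) := by ring
        rw [this, ENNReal.ofReal_mul zero_le_two, ENNReal.ofReal_mul zero_le_two]
        ring
    _ ≤ _ := by
        rw [hM, ENNReal.ofReal_toReal hbdd.eLpNorm_ne_top]
        gcongr
        -- Only 15 ≤ 16 + 4√π is needed.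
        linarith [Real.sqrt_nonneg Real.pi]
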